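/- Let $X$ be a real Banach space with $\dim X \ge 3$ (finite or infinite). Suppose that $X$ contains a 1-complemented hyperplane, i.e. a linear subspace $Y\subset X$ of codimension one for which there is a bounded linear projection $P\colon X\to X$ with range $Y$ and $\|P\|=1$. Suppose moreover that the group of isometries of $X$ is almost transitive, i.e. for every $x$ in the unit sphere $S_X=\{x\in X:\|x\|=1\}$ the orbit $\{Tx : T \text{ a linear isometry of } X \text{ onto } X\}$ is dense in $S_X$. Then $X$ is isometric to a Hilbert space: there is a real Hilbert space $H$ and a linear isometry of $X$ onto $H$. -/

import Mathlib

universe u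

/-- The subspace `Y` is 1-complemented: it is the range of a bounded
linear projection on `X` of operator norm one. -/
def IsOneComplemented {X : Type*} [NormedAddCommGroup X] [NormedSpace ℝ X]
    (Y : Submodule ℝ X) : Prop :=
  ∃ P : X →L[ℝ] X, IsIdempotentElem P ∧ LinearMap.range (P : X →ₗ[ℝ] X) = Y ∧ ‖P‖ = 1

/-- A hyperplane is a linear subspace of codimension one. -/
def IsHyperplane {X : Type*} [NormedAddCommGroup X] [NormedSpace ℝ X]
    (Y : Submodule ℝ X) : Prop :=
  Module.finrank ℝ (X ⧸ Y) = 1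

/-- The isometry group of `X` (surjective linear isometries) is almost transitive: the orbit of
each point of the unit sphere is dense in the unit sphere. -/
def IsAlmostTransitive (X : Type*) [NormedAddCommGroup X] [NormedSpace ℝ X] : Prop :=
  ∀ x ∈ Metric.sphere (0 : X) 1,
    Metric.sphere (0 : X) 1 ⊆ closure {y : X | ∃ T : X ≃ₗᵢ[ℝ] X, T x = y}

/-!
A contractive projection with one-dimensional kernel `ℝ x` has the form `z ↦ z - f z • x` with
`f x = 1` (`IsContractiveAlong`). Isometries carry such a functional along the orbit of `x`, and
functionals contractive along a convergent sequence of directions accumulate at one contractive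
along the limit. So almost transitivity provides a contractive projection along every line
(`HasContractiveProjections`). This property passes to subspaces, and by the Jordan–von Neumann
theorem it is enough to prove the parallelogram law in subspaces `E` of finite dimension at least
three; there the claim is the theorem of Blaschke and Kakutani.

Write `F x` for a functional contractive along `x`, and `J z` for one norming `z`. Always
`0 ≤ F x z * J z x` (`IsContractiveAlong.mul_nonneg`). The norm of `E` is strictly convex: a segment
in the sphere would give two different contractive projections along its direction, hence a family
of parallel segments in the sphere, which is incompatible with contractive projections along nearby
directions (`not_two_projections`). With strict convexity, a dimension count shows that every
nonzero functional is some `F x`, so the adjoint projections give the dual of `E` the same property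
(`HasContractiveProjections.dual`). The dual norm is therefore strictly convex as well, so `E` is
smooth, and `F x z` and `J z x` have the same sign and the same zeros.

Consequently `x ↦ F x` maps planes to planes and segments to segments, up to positive factors, and
by the argument of the fundamental theorem of projective geometry it is linear up to positive
factors (`SignCompatible.exists_linear`): there is a bilinear form `B`, positive on the diagonal,
such that `B x y = 0` implies `‖y‖ ≤ ‖y + x‖`. On a circle of the symmetric part of `B` this bounds
the logarithmic growth of the norm below, at a rate given by the skew part. Since the norm is
periodic on the circle, the rate vanishes and the norm is constant there
(`norm_eq_of_apply_self_eq_one`). So the square of the norm is a quadratic form.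
-/

open Filter Topology

/-! ### Functionals that are contractive along a direction -/

/-- `f` is normalised at `x` and the projection `z ↦ z - f z • x`, with kernel `ℝ x` and range
`ker f`, is contractive. Linearity alone is asked of `f`: boundedness is automatic. -/
def IsContractiveAlong {E : Type*} [NormedAddCommGroup E] [NormedSpace ℝ E]
    (x : E) (f : E →ₗ[ℝ] ℝ) : Prop :=
  f x = 1 ∧ ∀ z, ‖z - f z • x‖ ≤ ‖z‖

/-- Every line of `E` is the kernel of a contractive projection onto a hyperplane. -/
def HasContractiveProjections (E : Type*) [NormedAddCommGroup E] [NormedSpace ℝ E] : Prop :=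
  ∀ x : E, x ≠ 0 → ∃ f : E →ₗ[ℝ] ℝ, IsContractiveAlong x f

/-- `j` lies in the unit ball of the dual and attains the norm of `z`. -/
def IsNorming {E : Type*} [NormedAddCommGroup E] [NormedSpace ℝ E]
    (j : StrongDual ℝ E) (z : E) : Prop :=
  ‖j‖ ≤ 1 ∧ j z = ‖z‖

section Basic

variable {E : Type*} [NormedAddCommGroup E] [NormedSpace ℝ E]

theorem IsNorming.le {j : StrongDual ℝ E} {z : E} (hj : IsNorming j z) (w : E) : j w ≤ ‖w‖ := by
  have h := j.le_of_opNorm_le hj.1 w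
  rw [one_mul] at h
  exact (le_abs_self _).trans h

theorem exists_isNorming (z : E) : ∃ j : StrongDual ℝ E, IsNorming j z := by
  obtain ⟨j, hj, hz⟩ := exists_dual_vector'' ℝ z
  exact ⟨j, hj, by simpa using hz⟩

theorem IsContractiveAlong.ne_zero {x : E} {f : E →ₗ[ℝ] ℝ} (h : IsContractiveAlong x f) :
    x ≠ 0 := by
  rintro rfl
  simpa using h.1

theorem IsContractiveAlong.abs_mul_norm_le {x : E} {f : E →ₗ[ℝ] ℝ} (h : IsContractiveAlong x f)
    (z : E) : |f z| * ‖x‖ ≤ 2 * ‖z‖ := by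
  have h1 : f z • x = z - (z - f z • x) := by abel
  have h2 := norm_sub_le z (z - f z • x)
  rw [← h1, norm_smul, Real.norm_eq_abs] at h2
  linarith [h.2 z]

theorem IsContractiveAlong.smul {x : E} {f : E →ₗ[ℝ] ℝ} (h : IsContractiveAlong x f)
    {t : ℝ} (ht : t ≠ 0) : IsContractiveAlong (t • x) (t⁻¹ • f) := by
  refine ⟨by simp [h.1, ht], fun z => ?_⟩
  have : (t⁻¹ • f) z • t • x = f z • x := by
    rw [LinearMap.smul_apply, smul_smul, smul_eq_mul]
    congr 1
    field_simp
  rw [this]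
  exact h.2 z

/-- A functional norming `z` does not increase along the segment from `z` to its contractive image
`z - f z • x`, which forces `f z` and `j x` to have compatible signs. -/
theorem IsContractiveAlong.mul_nonneg {x z : E} {f : E →ₗ[ℝ] ℝ} {j : StrongDual ℝ E}
    (h : IsContractiveAlong x f) (hj : IsNorming j z) : 0 ≤ f z * j x := by
  have h1 := (hj.le (z - f z • x)).trans (h.2 z)
  rw [map_sub, hj.2, map_smul, smul_eq_mul] at h1
  linarith

/-- Range vectors of the projection are Birkhoff orthogonal to its kernel. -/
theorem IsContractiveAlong.norm_le {x z : E} {f : E →ₗ[ℝ] ℝ} (h : IsContractiveAlong x f)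
    (hz : f z = 0) (t : ℝ) : ‖z‖ ≤ ‖z + t • x‖ := by
  simpa [hz, h.1] using h.2 (z + t • x)

/-- The graph of the relation `IsContractiveAlong` is closed, and sections of it are compact in the
topology of pointwise convergence. The limit functional is taken along an ultrafilter. -/
theorem IsContractiveAlong.exists_of_tendsto {x : E} (hx : x ≠ 0) {u : ℕ → E}
    (hu : Tendsto u atTop (𝓝 x)) {f : ℕ → E →ₗ[ℝ] ℝ} (hf : ∀ n, IsContractiveAlong (u n) (f n)) :
    ∃ g : E →ₗ[ℝ] ℝ, IsContractiveAlong x g ∧ (∀ z, (∀ n, 0 ≤ f n z) → 0 ≤ g z) ∧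
      ∀ z, (∀ n, f n z ≤ 0) → g z ≤ 0 := by
  have hle : (hyperfilter ℕ : Filter ℕ) ≤ atTop := Nat.hyperfilter_le_atTop
  have hux : Tendsto u (hyperfilter ℕ) (𝓝 x) := hu.mono_left hle
  have hx2 : 0 < ‖x‖ / 2 := by positivity
  have hbig : ∀ᶠ n in (hyperfilter ℕ : Filter ℕ), ‖x‖ / 2 < ‖u n‖ :=
    hux.norm.eventually (lt_mem_nhds (by linarith))
  have hlim : ∀ z, ∃ a, Tendsto (fun n => f n z) (hyperfilter ℕ) (𝓝 a) := by
    intro z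
    have hb : ∀ᶠ n in (hyperfilter ℕ : Filter ℕ),
        f n z ∈ Set.Icc (-(2 * ‖z‖ / (‖x‖ / 2))) (2 * ‖z‖ / (‖x‖ / 2)) := by
      filter_upwards [hbig] with n hn
      have h1 := (hf n).abs_mul_norm_le z
      have h2 : |f n z| ≤ 2 * ‖z‖ / (‖x‖ / 2) := by
        rw [le_div_iff₀ hx2]
        exact (mul_le_mul_of_nonneg_left hn.le (abs_nonneg _)).trans h1
      exact abs_le.1 h2
    obtain ⟨a, -, ha⟩ := isCompact_Icc.ultrafilter_le_nhds
      ((hyperfilter ℕ).map fun n => f n z) (tendsto_principal.2 hb)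
    exact ⟨a, ha⟩
  choose g hg using hlim
  refine ⟨⟨⟨g, fun a b => ?_⟩, fun t a => ?_⟩, ⟨?_, fun z => ?_⟩, fun z hz => ?_, fun z hz => ?_⟩
  · exact tendsto_nhds_unique (hg (a + b)) (by simpa using (hg a).add (hg b))
  · exact tendsto_nhds_unique (hg (t • a)) (by simpa using (hg a).const_mul t)
  · -- `f n x = 1 + f n (x - u n)`, and the last term tends to zero.
    have h1 : Tendsto (fun n => f n x - 1) (hyperfilter ℕ) (𝓝 0) := by
      have h2 : Tendsto (fun n => 2 * ‖x - u n‖ / (‖x‖ / 2)) (hyperfilter ℕ) (𝓝 0) := by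
        have := (((tendsto_const_nhds (x := x)).sub hux).norm.const_mul 2).div_const (‖x‖ / 2)
        simpa using this
      refine squeeze_zero_norm' ?_ h2
      filter_upwards [hbig] with n hn
      have h3 := (hf n).abs_mul_norm_le (x - u n)
      rw [map_sub, (hf n).1] at h3
      rw [le_div_iff₀ hx2, Real.norm_eq_abs]
      exact (mul_le_mul_of_nonneg_left hn.le (abs_nonneg _)).trans h3
    have h4 := tendsto_nhds_unique h1 ((hg x).sub_const 1)
    change g x = 1
    linarith
  · have h1 : Tendsto (fun n => ‖z - f n z • u n‖) (hyperfilter ℕ) (𝓝 ‖z - g z • x‖) :=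
      (tendsto_const_nhds.sub ((hg z).smul hux)).norm
    exact le_of_tendsto' h1 fun n => (hf n).2 z
  · exact ge_of_tendsto' (hg z) hz
  · exact le_of_tendsto' (hg z) hz

end Basic

/-! ### Strict convexity -/

section StrictConvexity

variable {E : Type*} [NormedAddCommGroup E] [NormedSpace ℝ E]

/-- A plane contains a boundary point of the unit ball off a prescribed line that is strictly
exposed by a tangent direction: it is found where a Euclidean circle touches the ball. -/
theorem exists_strictly_exposed {w₀ w₁ : E} (h : LinearIndependent ℝ ![w₀, w₁]) :
    ∃ c s p q : ℝ, 0 < c ∧ ∀ τ : ℝ, τ ≠ 0 →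
      ‖c • w₀ + s • w₁‖ < ‖(c • w₀ + s • w₁) + τ • (p • w₀ + q • w₁)‖ := by
  have hpair := LinearIndependent.pair_iff.1 h
  have hw1 : w₁ ≠ 0 := fun h0 => by simpa using (hpair 0 1 (by simp [h0])).2
  -- Rescaling `w₁` makes it long, so that the minimum below is not attained on `ℝ w₁`.
  obtain ⟨r, hr, hrw⟩ : ∃ r : ℝ, 0 < r ∧ ‖w₀‖ < ‖r • w₁‖ := by
    have hpos : 0 < ‖w₁‖ := norm_pos_iff.2 hw1
    refine ⟨(‖w₀‖ + 1) / ‖w₁‖, by positivity, ?_⟩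
    rw [norm_smul, Real.norm_eq_abs, abs_of_pos (by positivity), div_mul_cancel₀ _ hpos.ne']
    linarith
  have hcont : Continuous fun θ : ℝ => ‖Real.cos θ • w₀ + Real.sin θ • r • w₁‖ := by fun_prop
  obtain ⟨θ, -, hθ⟩ := (isCompact_Icc (a := -Real.pi) (b := Real.pi)).exists_isMinOn
    ⟨0, by constructor <;> linarith [Real.pi_pos]⟩ hcont.continuousOn
  set m := ‖Real.cos θ • w₀ + Real.sin θ • r • w₁‖ with hm
  have hmin : ∀ s t : ℝ, m * √(s ^ 2 + t ^ 2) ≤ ‖s • w₀ + t • r • w₁‖ := by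
    intro s t
    set z : ℂ := ⟨s, t⟩ with hz
    have hs : s = ‖z‖ * Real.cos z.arg := by rw [Complex.norm_mul_cos_arg]
    have ht : t = ‖z‖ * Real.sin z.arg := by rw [Complex.norm_mul_sin_arg]
    have hn : √(s ^ 2 + t ^ 2) = ‖z‖ := by
      rw [Complex.norm_eq_sqrt_sq_add_sq]
    have h1 : m ≤ ‖Real.cos z.arg • w₀ + Real.sin z.arg • r • w₁‖ :=
      hθ ⟨(Complex.neg_pi_lt_arg z).le, Complex.arg_le_pi z⟩
    have h2 : s • w₀ + t • r • w₁ = ‖z‖ • (Real.cos z.arg • w₀ + Real.sin z.arg • r • w₁) := by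
      rw [smul_add, smul_smul ‖z‖ (Real.cos _) w₀, smul_smul ‖z‖ (Real.sin _) (r • w₁), ← hs, ← ht]
    rw [hn, h2, norm_smul, norm_norm, mul_comm]
    exact mul_le_mul_of_nonneg_left h1 (norm_nonneg _)
  have hm0 : 0 < m := by
    rw [hm, norm_pos_iff]
    intro h0
    rw [smul_smul] at h0
    obtain ⟨hc, hs⟩ := hpair _ _ h0
    have hs' : Real.sin θ = 0 := by simpa [hr.ne'] using hs
    have := Real.sin_sq_add_cos_sq θ
    rw [hc, hs'] at this
    norm_num at this
  have hcos : Real.cos θ ≠ 0 := by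
    intro hc
    have h1 : m ≤ ‖w₀‖ := by
      simpa using hmin 1 0
    have h2 : |Real.sin θ| = 1 := by
      have := Real.sin_sq_add_cos_sq θ
      rw [hc] at this
      have h3 : Real.sin θ ^ 2 = 1 := by linarith
      rw [← sq_abs] at h3
      nlinarith [abs_nonneg (Real.sin θ)]
    rw [hm, hc, zero_smul, zero_add, norm_smul, Real.norm_eq_abs, h2, one_mul] at h1
    linarith
  -- A sign makes the first coefficient positive.
  obtain ⟨e, he, hec⟩ : ∃ e : ℝ, e ^ 2 = 1 ∧ 0 < e * Real.cos θ := by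
    rcases lt_or_gt_of_ne hcos with hc | hc
    · exact ⟨-1, by norm_num, by linarith⟩
    · exact ⟨1, by norm_num, by linarith⟩
  have habs : |e| = 1 := by
    rw [← sq_abs] at he
    nlinarith [abs_nonneg e]
  refine ⟨e * Real.cos θ, e * Real.sin θ * r, -(e * Real.sin θ), e * Real.cos θ * r, hec, ?_⟩
  intro τ hτ
  have h1 : (e * Real.cos θ) • w₀ + (e * Real.sin θ * r) • w₁ =
      e • (Real.cos θ • w₀ + Real.sin θ • r • w₁) := by module
  have h2 : ((e * Real.cos θ) • w₀ + (e * Real.sin θ * r) • w₁) +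
      τ • (-(e * Real.sin θ) • w₀ + (e * Real.cos θ * r) • w₁) =
      (e * Real.cos θ - τ * (e * Real.sin θ)) • w₀ +
        (e * Real.sin θ + τ * (e * Real.cos θ)) • r • w₁ := by module
  have h3 : (e * Real.cos θ - τ * (e * Real.sin θ)) ^ 2 +
      (e * Real.sin θ + τ * (e * Real.cos θ)) ^ 2 = 1 + τ ^ 2 := by
    linear_combination (1 + τ ^ 2) * Real.sin_sq_add_cos_sq θ * e ^ 2 + (1 + τ ^ 2) * he
  have h4 := hmin (e * Real.cos θ - τ * (e * Real.sin θ)) (e * Real.sin θ + τ * (e * Real.cos θ))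
  rw [h3] at h4
  rw [h2, h1, norm_smul, Real.norm_eq_abs, habs, one_mul, ← hm]
  refine lt_of_lt_of_le ?_ h4
  have h5 : 1 < √(1 + τ ^ 2) := by
    rw [Real.lt_sqrt (by norm_num)]
    have := sq_pos_of_ne_zero hτ
    linarith
  nlinarith

/-- If two different contractive projections share the kernel `ℝ x`, the points `w` halfway between
their ranges lie inside segments of the sphere parallel to `x`, so the functionals norming `w`
norm these segments. -/
theorem IsNorming.of_two_projections {x w : E} {f g : E →ₗ[ℝ] ℝ} {j : StrongDual ℝ E}
    (hf : IsContractiveAlong x f) (hg : IsContractiveAlong x g) (hw : f w + g w = 0)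
    (hpos : 0 < f w) (hj : IsNorming j w) :
    j x = 0 ∧ IsNorming j (w + f w • x) ∧ IsNorming j (w - f w • x) := by
  have h1 : ‖w - f w • x‖ ≤ ‖w‖ := hf.2 w
  have h2 : ‖w + f w • x‖ ≤ ‖w‖ := by
    have := hg.2 w
    rwa [show g w = -f w by linarith, neg_smul, sub_neg_eq_add] at this
  have h3 := (hj.le _).trans h1
  have h4 := (hj.le _).trans h2
  rw [map_sub, map_smul, hj.2, smul_eq_mul] at h3
  rw [map_add, map_smul, hj.2, smul_eq_mul] at h4
  have hjx : j x = 0 := by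
    have : f w * j x = 0 := by linarith
    exact (mul_eq_zero.1 this).resolve_left hpos.ne'
  have h5 := hj.le (w - f w • x)
  have h6 := hj.le (w + f w • x)
  rw [map_sub, map_smul, hj.2, hjx, smul_zero, sub_zero] at h5
  rw [map_add, map_smul, hj.2, hjx, smul_zero, add_zero] at h6
  refine ⟨hjx, ⟨hj.1, ?_⟩, ⟨hj.1, ?_⟩⟩
  · rw [map_add, map_smul, hj.2, hjx, smul_zero, add_zero]
    exact le_antisymm h6 h2
  · rw [map_sub, map_smul, hj.2, hjx, smul_zero, sub_zero]
    exact le_antisymm h5 h1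

/-- A segment `[a, b]` in the unit sphere yields two different contractive projections along
`x = b - a`, as limits of contractive projections along `x ± (a + b) / n`: one limit is nonnegative
at `a`, the other nonpositive at `b`. -/
theorem exists_two_projections_of_segment (H : HasContractiveProjections E) {a b : E}
    (ha : ‖a‖ = 1) (hb : ‖b‖ = 1) (hab : a ≠ b) (h2 : ‖a + b‖ = 2) :
    ∃ f g : E →ₗ[ℝ] ℝ, IsContractiveAlong (b - a) f ∧ IsContractiveAlong (b - a) g ∧
      0 ≤ f a ∧ g b ≤ 0 := by
  have hx : b - a ≠ 0 := sub_ne_zero.2 hab.symm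
  obtain ⟨j, hj⟩ := exists_isNorming (a + b)
  have hja := hj.le a
  have hjb := hj.le b
  have hjab := hj.2
  rw [map_add, h2] at hjab
  have ha1 : j a = 1 := by linarith
  have hb1 : j b = 1 := by linarith
  have hJa : IsNorming j a := ⟨hj.1, by rw [ha1, ha]⟩
  have hJb : IsNorming j b := ⟨hj.1, by rw [hb1, hb]⟩
  have key : ∀ s : ℝ, s ≠ 0 → ∃ u : ℕ → E, Tendsto u atTop (𝓝 (b - a)) ∧
      ∀ n, ∃ t : ℝ, 0 < t ∧ j (u n) = t * s := by
    intro s hs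
    refine ⟨fun n => (b - a) + (1 / ((n : ℝ) + 1)) • s • (a + b), ?_, fun n => ?_⟩
    · have h := (tendsto_one_div_add_atTop_nhds_zero_nat (𝕜 := ℝ)).smul_const (s • (a + b))
      simpa using h.const_add (b - a)
    · refine ⟨1 / ((n : ℝ) + 1) * 2, by positivity, ?_⟩
      simp only [map_add, map_sub, map_smul, ha1, hb1, smul_eq_mul]
      ring
  have key2 : ∀ s : ℝ, s ≠ 0 → ∃ f : E →ₗ[ℝ] ℝ, IsContractiveAlong (b - a) f ∧
      ∀ z, IsNorming j z → 0 ≤ f z * s := by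
    intro s hs
    obtain ⟨u, hu, hju⟩ := key s hs
    choose t ht hjt using hju
    have hne : ∀ n, u n ≠ 0 := by
      intro n h0
      have := hjt n
      rw [h0, map_zero] at this
      exact mul_ne_zero (ht n).ne' hs this.symm
    choose φ hφ using fun n => H (u n) (hne n)
    obtain ⟨f, hf, hp, hn⟩ := IsContractiveAlong.exists_of_tendsto hx hu hφ
    refine ⟨f, hf, fun z hz => ?_⟩
    have hsign : ∀ n, 0 ≤ φ n z * s := by
      intro n
      have h := (hφ n).mul_nonneg hz
      rw [hjt n] at h
      refine nonneg_of_mul_nonneg_right (a := t n) ?_ (ht n)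
      linarith
    rcases lt_or_gt_of_ne hs with hs' | hs'
    · exact mul_nonneg_of_nonpos_of_nonpos
        (hn z fun n => nonpos_of_mul_nonneg_left (hsign n) hs') hs'.le
    · exact mul_nonneg (hp z fun n => nonneg_of_mul_nonneg_left (hsign n) hs') hs'.le
  obtain ⟨f, hf, hfp⟩ := key2 1 one_ne_zero
  obtain ⟨g, hg, hgp⟩ := key2 (-1) (by norm_num)
  have h3 := hfp a hJa
  have h4 := hgp b hJb
  exact ⟨f, g, hf, hg, by linarith, by linarith⟩

/-- Two different contractive projections cannot share the kernel `ℝ x`. The functional `f - g`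
vanishes at `x`; on the plane of `ker (f + g)` spanned by `w₀` and some `w₁ ∈ ker (f - g)` there is
a point `w` strictly exposed by a direction `n`. The functionals norming the segments parallel to
`x` around `w + τ n` change sign at `n` together with `τ`, so any functional contractive along
`x + ε n` vanishes on the segment around `w`, hence at `x`; this is absurd for small `ε`. -/
theorem not_two_projections [FiniteDimensional ℝ E] (hdim : 3 ≤ Module.finrank ℝ E)
    (H : HasContractiveProjections E) {x w₀ : E} {f g : E →ₗ[ℝ] ℝ}
    (hf : IsContractiveAlong x f) (hg : IsContractiveAlong x g)
    (hw₀ : f w₀ + g w₀ = 0) (hpos : 0 < f w₀) : False := by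
  have hx := hf.ne_zero
  obtain ⟨w₁, hw₁, hker⟩ : ∃ w₁ : E, w₁ ≠ 0 ∧ (f.prod g) w₁ = 0 := by
    have hk : LinearMap.ker (f.prod g) ≠ ⊥ :=
      LinearMap.ker_ne_bot_of_finrank_lt (by simp; omega)
    obtain ⟨v, hv, hv0⟩ := Submodule.exists_mem_ne_zero_of_ne_bot hk
    exact ⟨v, hv0, hv⟩
  have hf₁ : f w₁ = 0 := congrArg Prod.fst hker
  have hg₁ : g w₁ = 0 := congrArg Prod.snd hker
  have hli : LinearIndependent ℝ ![w₀, w₁] := by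
    rw [LinearIndependent.pair_iff]
    intro s t hst
    have h1 : f (s • w₀ + t • w₁) = 0 := by rw [hst, map_zero]
    simp only [map_add, map_smul, hf₁, smul_eq_mul, mul_zero, add_zero] at h1
    have hs : s = 0 := (mul_eq_zero.1 h1).resolve_right hpos.ne'
    subst hs
    refine ⟨rfl, ?_⟩
    simpa [hw₁] using hst
  obtain ⟨c, s, p, q, hc, hexp⟩ := exists_strictly_exposed hli
  set w := c • w₀ + s • w₁ with hw
  set n := p • w₀ + q • w₁ with hn
  have hfw : 0 < f w := by
    simp only [hw, map_add, map_smul, hf₁, smul_eq_mul, mul_zero, add_zero]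
    positivity
  have hsum : ∀ τ : ℝ, f (w + τ • n) + g (w + τ • n) = 0 := by
    intro τ
    simp only [hw, hn, map_add, map_smul, hf₁, hg₁, smul_eq_mul, mul_zero, add_zero]
    linear_combination (c + τ * p) * hw₀
  obtain ⟨ε, hε, hεn⟩ : ∃ ε : ℝ, 0 < ε ∧ 3 * (ε * ‖n‖) < ‖x‖ := by
    have hxn : 0 < ‖x‖ := norm_pos_iff.2 hx
    refine ⟨‖x‖ / (3 * ‖n‖ + 1), by positivity, ?_⟩
    rw [div_mul_eq_mul_div, mul_div_assoc', div_lt_iff₀ (by positivity)]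
    linarith
  have hxε : ‖x‖ - ε * ‖n‖ ≤ ‖x + ε • n‖ := by
    have h1 := norm_sub_le (x + ε • n) (ε • n)
    rw [add_sub_cancel_right, norm_smul, Real.norm_eq_abs, abs_of_pos hε] at h1
    linarith
  have hεnn : 0 ≤ ε * ‖n‖ := by positivity
  have hne : x + ε • n ≠ 0 := by
    rw [← norm_pos_iff]
    linarith
  obtain ⟨φ, hφ⟩ := H _ hne
  -- The sign of `φ` at the two ends of the segment around `w + τ n` is that of `τ`.
  have hsign : ∀ τ : ℝ, τ ≠ 0 → 0 < f (w + τ • n) → ∀ σ : ℝ, σ = 1 ∨ σ = -1 →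
      0 ≤ φ ((w + τ • n) + σ • f (w + τ • n) • x) * τ := by
    intro τ hτ hfpos σ hσ
    obtain ⟨j, hj⟩ := exists_isNorming (w + τ • n)
    obtain ⟨hjx, hj1, hj2⟩ := IsNorming.of_two_projections hf hg (hsum τ) hfpos hj
    have hjn : 0 < τ * j n := by
      have h1 := hj.le w
      have h2 := hj.2
      rw [map_add, map_smul, smul_eq_mul] at h2
      linarith [hexp τ hτ]
    have hjσ : IsNorming j ((w + τ • n) + σ • f (w + τ • n) • x) := by
      rcases hσ with rfl | rfl
      · simpa using hj1
      · simpa [sub_eq_add_neg] using hj2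
    have hjε : j (x + ε • n) = ε * j n := by
      rw [map_add, map_smul, hjx, zero_add, smul_eq_mul]
    have h3 := hφ.mul_nonneg hjσ
    rw [hjε] at h3
    have h4 : 0 ≤ (φ ((w + τ • n) + σ • f (w + τ • n) • x) * τ) * (ε * (τ * j n)) := by
      have : (φ ((w + τ • n) + σ • f (w + τ • n) • x) * τ) * (ε * (τ * j n)) =
        (φ ((w + τ • n) + σ • f (w + τ • n) • x) * (ε * j n)) * τ ^ 2 := by ring
      rw [this]
      exact mul_nonneg h3 (sq_nonneg _)
    exact nonneg_of_mul_nonneg_left h4 (by positivity)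
  have hzero : ∀ σ : ℝ, σ = 1 ∨ σ = -1 → φ (w + σ • f w • x) = 0 := by
    intro σ hσ
    set A := φ (w + σ • f w • x) with hA
    set B := φ n + σ * f n * φ x with hB
    have hlin : ∀ τ : ℝ, φ ((w + τ • n) + σ • f (w + τ • n) • x) = A + τ * B := by
      intro τ
      simp only [hA, hB, map_add, map_smul, smul_eq_mul]
      ring
    have hcont : Continuous fun τ : ℝ => A + τ * B := by fun_prop
    have hT : Tendsto (fun τ : ℝ => A + τ * B) (𝓝 0) (𝓝 A) := by
      simpa using hcont.tendsto 0
    have hfe : ∀ᶠ τ : ℝ in 𝓝 0, 0 < f (w + τ • n) := by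
      have hcf : Continuous fun τ : ℝ => f w + τ * f n := by fun_prop
      have h0 : Tendsto (fun τ : ℝ => f w + τ * f n) (𝓝 0) (𝓝 (f w)) := by
        simpa using hcf.tendsto 0
      filter_upwards [h0.eventually (lt_mem_nhds hfw)] with τ hτ
      simpa using hτ
    apply le_antisymm
    · refine le_of_tendsto (hT.mono_left (nhdsWithin_le_nhds (s := Set.Iio 0))) ?_
      filter_upwards [nhdsWithin_le_nhds hfe, self_mem_nhdsWithin] with τ h1 h2
      have h3 := hsign τ (ne_of_lt h2) h1 σ hσ
      rw [hlin] at h3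
      exact nonpos_of_mul_nonneg_left h3 h2
    · refine ge_of_tendsto (hT.mono_left (nhdsWithin_le_nhds (s := Set.Ioi 0))) ?_
      filter_upwards [nhdsWithin_le_nhds hfe, self_mem_nhdsWithin] with τ h1 h2
      have h3 := hsign τ (ne_of_gt h2) h1 σ hσ
      rw [hlin] at h3
      exact nonneg_of_mul_nonneg_left h3 h2
  have h1 := hzero 1 (Or.inl rfl)
  have h2 := hzero (-1) (Or.inr rfl)
  simp only [map_add, map_smul, smul_eq_mul] at h1 h2
  have hφx : φ x = 0 := by
    have : f w * φ x = 0 := by linarith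
    exact (mul_eq_zero.1 this).resolve_left hfw.ne'
  have h3 := hφ.1
  rw [map_add, map_smul, hφx, zero_add, smul_eq_mul] at h3
  have h4 := hφ.abs_mul_norm_le (ε • n)
  rw [map_smul, smul_eq_mul, h3, abs_one, one_mul, norm_smul, Real.norm_eq_abs,
    abs_of_pos hε] at h4
  linarith

theorem HasContractiveProjections.strictConvexSpace [FiniteDimensional ℝ E]
    (hdim : 3 ≤ Module.finrank ℝ E) (H : HasContractiveProjections E) :
    StrictConvexSpace ℝ E := by
  refine StrictConvexSpace.of_norm_add_ne_two fun a b ha hb hab h2 => ?_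
  obtain ⟨f, g, hf, hg, hfa, hgb⟩ := exists_two_projections_of_segment H ha hb hab h2
  have hf1 := hf.1
  have hg1 := hg.1
  rw [map_sub] at hf1 hg1
  -- The point of the line through `a` and `b` on which `f + g` vanishes.
  refine not_two_projections hdim H (w₀ := a - ((f a + g a) / 2) • (b - a)) hf hg ?_ ?_
  · simp only [map_sub, map_smul, smul_eq_mul, hf1, hg1]
    ring
  · simp only [map_sub, map_smul, smul_eq_mul, hf1]
    linarith

end StrictConvexity

/-! ### Smoothness by duality -/

section Smoothness

variable {E : Type*} [NormedAddCommGroup E] [NormedSpace ℝ E]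

theorem IsContractiveAlong.eq_zero_of_orthogonal [StrictConvexSpace ℝ E] {x z : E}
    {f : E →ₗ[ℝ] ℝ} (hf : IsContractiveAlong x f) (h : ∀ t : ℝ, ‖z‖ ≤ ‖z + t • x‖) :
    f z = 0 := by
  by_contra hne
  have h1 : ‖z‖ = ‖z - f z • x‖ := by
    refine le_antisymm ?_ (hf.2 z)
    simpa [sub_eq_add_neg] using h (-f z)
  have h2 : z ≠ z - f z • x := by
    intro h3
    have h4 : f z • x = 0 := by
      rw [← sub_eq_self]
      exact h3.symm
    exact (smul_ne_zero hne hf.ne_zero) h4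
  have h3 := (norm_midpoint_lt_iff h1).2 h2
  have h4 := h (-(f z / 2))
  have h5 : z + (-(f z / 2)) • x = (1 / 2 : ℝ) • (z + (z - f z • x)) := by module
  rw [h5] at h4
  linarith

theorem IsContractiveAlong.eq_zero_of_isNorming [StrictConvexSpace ℝ E] {x z : E}
    {f : E →ₗ[ℝ] ℝ} {j : StrongDual ℝ E} (hf : IsContractiveAlong x f) (hj : IsNorming j z)
    (hx : j x = 0) : f z = 0 := by
  refine hf.eq_zero_of_orthogonal fun t => ?_
  have := hj.le (z + t • x)
  rwa [map_add, map_smul, hx, smul_zero, add_zero, hj.2] at this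

theorem IsContractiveAlong.unique [StrictConvexSpace ℝ E] {x : E} {f g : E →ₗ[ℝ] ℝ}
    (hf : IsContractiveAlong x f) (hg : IsContractiveAlong x g) : f = g := by
  ext z
  have h1 : f (z - f z • x) = 0 := by simp [hf.1]
  have h2 := hg.eq_zero_of_orthogonal (hf.norm_le h1)
  rw [map_sub, map_smul, hg.1, smul_eq_mul, mul_one] at h2
  linarith

/-- Every hyperplane `ker g` is the range of a contractive projection: the kernel is found as a
common zero of functionals norming the vectors of a basis of `ker g`, which exists by counting
dimensions. -/
theorem HasContractiveProjections.exists_isContractiveAlong [FiniteDimensional ℝ E]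
    [StrictConvexSpace ℝ E] (H : HasContractiveProjections E) {g : E →ₗ[ℝ] ℝ} (hg : g ≠ 0) :
    ∃ y : E, IsContractiveAlong y g := by
  set b := Module.finBasis ℝ (LinearMap.ker g) with hb
  choose J hJ using fun z : E => exists_isNorming z
  let Φ : E →ₗ[ℝ] (Fin (Module.finrank ℝ (LinearMap.ker g)) → ℝ) :=
    LinearMap.pi fun i => (J (b i : E) : E →ₗ[ℝ] ℝ)
  have hlt : Module.finrank ℝ (LinearMap.ker g) < Module.finrank ℝ E := by
    refine Submodule.finrank_lt ?_
    rwa [Ne, LinearMap.ker_eq_top]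
  have hk : LinearMap.ker Φ ≠ ⊥ := LinearMap.ker_ne_bot_of_finrank_lt (by simpa using hlt)
  obtain ⟨x, hx, hx0⟩ := Submodule.exists_mem_ne_zero_of_ne_bot hk
  obtain ⟨f, hf⟩ := H x hx0
  have hfb : ∀ i, f (b i : E) = 0 := fun i =>
    hf.eq_zero_of_isNorming (hJ (b i : E)) (congrFun (LinearMap.mem_ker.1 hx) i)
  have hres : f.comp (LinearMap.ker g).subtype = 0 := b.ext fun i => by simpa using hfb i
  have hker : ∀ z, g z = 0 → f z = 0 := fun z hz => LinearMap.congr_fun hres ⟨z, hz⟩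
  have hgx : g x ≠ 0 := fun h0 => by
    have h1 := hker x h0
    rw [hf.1] at h1
    exact one_ne_zero h1
  have hfg : ∀ z, f z = g z / g x := by
    intro z
    have h1 := hker (z - (g z / g x) • x) (by simp [hgx])
    rw [map_sub, map_smul, hf.1, smul_eq_mul, mul_one] at h1
    linarith
  refine ⟨(g x)⁻¹ • x, by simp [hgx], fun z => ?_⟩
  have h1 := hf.2 z
  rwa [hfg, div_eq_mul_inv, mul_smul] at h1

theorem HasContractiveProjections.dual [FiniteDimensional ℝ E]
    [StrictConvexSpace ℝ E] (H : HasContractiveProjections E) :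
    HasContractiveProjections (StrongDual ℝ E) := by
  intro g hg
  have hg' : (g : E →ₗ[ℝ] ℝ) ≠ 0 := by
    intro h0
    apply hg
    ext z
    exact LinearMap.congr_fun h0 z
  obtain ⟨y, hy⟩ := H.exists_isContractiveAlong hg'
  refine ⟨(ContinuousLinearMap.apply ℝ ℝ y : StrongDual ℝ E →L[ℝ] ℝ), hy.1, fun h => ?_⟩
  refine ContinuousLinearMap.opNorm_le_bound _ (norm_nonneg _) fun z => ?_
  have h1 : (h - (ContinuousLinearMap.apply ℝ ℝ y : StrongDual ℝ E →L[ℝ] ℝ) h • g) z =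
      h (z - g z • y) := by
    simp [mul_comm]
  have h2 : ‖z - g z • y‖ ≤ ‖z‖ := hy.2 z
  calc _ = ‖h (z - g z • y)‖ := congrArg _ h1
    _ ≤ ‖h‖ * ‖z - g z • y‖ := h.le_opNorm _
    _ ≤ ‖h‖ * ‖z‖ := by gcongr

theorem HasContractiveProjections.strictConvexSpace_dual [FiniteDimensional ℝ E]
    (hdim : 3 ≤ Module.finrank ℝ E) (H : HasContractiveProjections E) :
    StrictConvexSpace ℝ (StrongDual ℝ E) := by
  have := H.strictConvexSpace hdim
  refine H.dual.strictConvexSpace ?_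
  rwa [← (LinearMap.toContinuousLinearMap (𝕜 := ℝ) (E := E) (F' := ℝ)).finrank_eq,
    Module.finrank_linearMap_self]

theorem IsNorming.unique [StrictConvexSpace ℝ (StrongDual ℝ E)] {z : E} (hz : z ≠ 0)
    {i j : StrongDual ℝ E} (hi : IsNorming i z) (hj : IsNorming j z) : i = j := by
  have hz' : 0 < ‖z‖ := norm_pos_iff.2 hz
  have h1 : ∀ k : StrongDual ℝ E, ∀ c : ℝ, k z = c * ‖z‖ → c ≤ ‖k‖ := by
    intro k c hk
    have h2 := (le_abs_self _).trans (k.le_opNorm z)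
    rw [hk] at h2
    exact le_of_mul_le_mul_right h2 hz'
  have h2 := h1 i 1 (by rw [hi.2, one_mul])
  have h3 := h1 j 1 (by rw [hj.2, one_mul])
  have h4 := h1 (i + j) 2 (by rw [add_apply, hi.2, hj.2]; ring)
  have h5 := hi.1
  have h6 := hj.1
  refine eq_of_norm_eq_of_norm_add_eq (by linarith) (le_antisymm (norm_add_le _ _) (by linarith))

theorem IsContractiveAlong.isNorming_eq_zero [FiniteDimensional ℝ E]
    [StrictConvexSpace ℝ (StrongDual ℝ E)] {x z : E} (hz : z ≠ 0) {f : E →ₗ[ℝ] ℝ}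
    {j : StrongDual ℝ E} (hf : IsContractiveAlong x f) (hj : IsNorming j z) (h : f z = 0) :
    j x = 0 := by
  -- Composing `j` with the projection gives a functional norming `z` and vanishing at `x`.
  let P : E →ₗ[ℝ] E := LinearMap.id - f.smulRight x
  let i : StrongDual ℝ E := j.comp (LinearMap.toContinuousLinearMap P)
  have hi : ∀ w, i w = j (w - f w • x) := fun w => rfl
  have hnorm : IsNorming i z := by
    refine ⟨ContinuousLinearMap.opNorm_le_bound _ zero_le_one fun w => ?_, ?_⟩
    · rw [hi]
      refine (j.le_opNorm _).trans ?_
      exact mul_le_mul hj.1 (hf.2 w) (norm_nonneg _) zero_le_one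
    · rw [hi, h, zero_smul, sub_zero, hj.2]
  rw [← IsNorming.unique hz hnorm hj, hi, hf.1, one_smul, sub_self, map_zero]

end Smoothness

/-! ### Sign compatible families are linear up to scale -/

section ProjectiveLinearity

theorem map_eq_mul_map_one_of_nonneg {f : ℝ → ℝ} (hadd : ∀ s t, f (s + t) = f s + f t)
    (hpos : ∀ t, 0 ≤ t → 0 ≤ f t) (t : ℝ) : f t = t * f 1 := by
  have hf0 : f 0 = 0 := by
    have := hadd 0 0
    rw [add_zero] at this
    linarith
  -- The defect `g` is additive, vanishes on integers and is bounded on `[0, 1]`.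
  set g : ℝ → ℝ := fun s => f s - s * f 1 with hg
  have hgadd : ∀ s u, g (s + u) = g s + g u := by
    intro s u
    simp only [hg, hadd]
    ring
  let G : ℝ →+ ℝ := ⟨⟨g, by simp [hg, hf0]⟩, hgadd⟩
  have hg1 : G 1 = 0 := by
    change g 1 = 0
    simp [hg]
  have hint : ∀ n : ℤ, G n = 0 := by
    intro n
    have := map_zsmul G n 1
    rwa [hg1, smul_zero, zsmul_eq_mul, mul_one] at this
  have hbd : ∀ s, |G s| ≤ f 1 := by
    intro s
    have h1 : G s = G (Int.fract s) := by
      conv_lhs => rw [← Int.floor_add_fract s]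
      rw [map_add, hint, zero_add]
    have h0 := Int.fract_nonneg s
    have h2 := (Int.fract_lt_one s).le
    have h3 := hpos _ h0
    have h4 := hpos (1 - Int.fract s) (by linarith)
    have h5 := hadd (Int.fract s) (1 - Int.fract s)
    rw [add_sub_cancel] at h5
    have h6 : f 1 ≥ 0 := hpos 1 zero_le_one
    rw [h1]
    change |f (Int.fract s) - Int.fract s * f 1| ≤ f 1
    rw [abs_le]
    constructor <;> nlinarith
  have hG : G t = 0 := by
    by_contra hne
    obtain ⟨n, hn⟩ := exists_nat_gt (f 1 / |G t|)
    have h1 := hbd (n • t)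
    rw [map_nsmul, nsmul_eq_mul, abs_mul, Nat.abs_cast] at h1
    rw [div_lt_iff₀ (abs_pos.2 hne)] at hn
    linarith
  have : f t - t * f 1 = 0 := hG
  linarith

/-- `F x` and `J z` are families of functionals normalised by `F x x = 1`, compatible in that
`F x z` and `J z x` have the same sign, and `F` is homogeneous of degree `-1`. -/
structure SignCompatible {E : Type*} [AddCommGroup E] [Module ℝ E] (F J : E → E →ₗ[ℝ] ℝ) :
    Prop where
  self : ∀ x, x ≠ 0 → F x x = 1
  smul : ∀ x, x ≠ 0 → ∀ t : ℝ, t ≠ 0 → F (t • x) = t⁻¹ • F x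
  zero_iff : ∀ x, x ≠ 0 → ∀ z, z ≠ 0 → (F x z = 0 ↔ J z x = 0)
  pos_iff : ∀ x, x ≠ 0 → ∀ z, z ≠ 0 → (0 < F x z ↔ 0 < J z x)

namespace SignCompatible

variable {E : Type*} [AddCommGroup E] [Module ℝ E] {F J : E → E →ₗ[ℝ] ℝ}

theorem pos_self (h : SignCompatible F J) {z : E} (hz : z ≠ 0) : 0 < J z z := by
  rw [← h.pos_iff z hz z hz, h.self z hz]
  exact one_pos

theorem exists_separating (h : SignCompatible F J) {x y : E}
    (hxy : LinearIndependent ℝ ![x, y]) : ∃ e, F x e = 0 ∧ F y e = 1 := by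
  have hx : x ≠ 0 := hxy.ne_zero 0
  have hy : y ≠ 0 := hxy.ne_zero 1
  set z := y - F x y • x with hz
  have hz0 : z ≠ 0 := by
    intro h0
    have := (LinearIndependent.pair_iff.1 hxy (-F x y) 1 (by rw [← h0, hz]; module)).2
    exact one_ne_zero this
  have h1 : F x z = 0 := by
    rw [hz, map_sub, map_smul, h.self x hx, smul_eq_mul, mul_one, sub_self]
  have h2 : J z x = 0 := (h.zero_iff x hx z hz0).1 h1
  have h3 : J z y = J z z := by
    conv_rhs => rw [hz]
    rw [map_sub, map_smul, h2, smul_zero, sub_zero]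
  have h4 : 0 < F y z := by
    rw [h.pos_iff y hy z hz0, h3]
    exact h.pos_self hz0
  exact ⟨(F y z)⁻¹ • z, by simp [h1], by simp [h4.ne']⟩

/-- `F` maps the plane of `x` and `y` into the plane of `F x` and `F y`, respecting the order of
the points on the segment from `x` to `y`. -/
theorem exists_map_add (h : SignCompatible F J) {x y : E} (hxy : LinearIndependent ℝ ![x, y]) :
    ∃ a b : ℝ, 0 < a ∧ 0 < b ∧ F (x + y) = a • F x + b • F y := by
  have hx : x ≠ 0 := hxy.ne_zero 0
  have hy : y ≠ 0 := hxy.ne_zero 1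
  have hs : x + y ≠ 0 := by
    intro h0
    have := (LinearIndependent.pair_iff.1 hxy 1 1 (by simpa using h0)).2
    exact one_ne_zero this
  obtain ⟨e₂, h2x, h2y⟩ := h.exists_separating hxy
  obtain ⟨e₁, h1y, h1x⟩ := h.exists_separating (LinearIndependent.pair_symm_iff.1 hxy)
  have he₁ : e₁ ≠ 0 := by
    rintro rfl
    simp at h1x
  have he₂ : e₂ ≠ 0 := by
    rintro rfl
    simp at h2y
  refine ⟨F (x + y) e₁, F (x + y) e₂, ?_, ?_, ?_⟩
  · rw [h.pos_iff _ hs _ he₁, map_add, (h.zero_iff y hy e₁ he₁).1 h1y, add_zero,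
      ← h.pos_iff x hx e₁ he₁, h1x]
    exact one_pos
  · rw [h.pos_iff _ hs _ he₂, map_add, (h.zero_iff x hx e₂ he₂).1 h2x, zero_add,
      ← h.pos_iff y hy e₂ he₂, h2y]
    exact one_pos
  · ext w
    set v := w - F x w • e₁ - F y w • e₂ with hv
    have hvz : F (x + y) v = 0 := by
      by_cases hv0 : v = 0
      · rw [hv0, map_zero]
      · have h1 : F x v = 0 := by simp [hv, h1x, h2x]
        have h2 : F y v = 0 := by simp [hv, h1y, h2y]
        rw [h.zero_iff _ hs v hv0, map_add, (h.zero_iff x hx v hv0).1 h1,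
          (h.zero_iff y hy v hv0).1 h2, add_zero]
    simp only [hv, map_sub, map_smul, smul_eq_mul] at hvz
    simp only [LinearMap.add_apply, LinearMap.smul_apply, smul_eq_mul]
    linarith

/-- `F x` rescaled to take the value one at `o`. -/
noncomputable def chart (F : E → E →ₗ[ℝ] ℝ) (o x : E) : E →ₗ[ℝ] ℝ := (F x o)⁻¹ • F x

theorem linearIndependent_of_chart {o x v : E} (hx : J o x = 1) (hv : J o v = 0) (hv0 : v ≠ 0) :
    LinearIndependent ℝ ![x, v] := by
  rw [LinearIndependent.pair_iff]
  intro s t hst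
  have h1 := congrArg (J o) hst
  simp only [map_add, map_smul, hx, hv, smul_eq_mul, mul_one, mul_zero, add_zero, map_zero] at h1
  subst h1
  refine ⟨rfl, ?_⟩
  simpa [hv0] using hst

theorem chart_sub (h : SignCompatible F J) {o x v : E} (ho : o ≠ 0) (hx : J o x = 1)
    (hv : J o v = 0) (hv0 : v ≠ 0) :
    ∃ c : ℝ, 0 < c ∧ chart F o (x + v) - chart F o x = c • F v := by
  have hli := linearIndependent_of_chart hx hv hv0
  have hx0 : x ≠ 0 := hli.ne_zero 0
  obtain ⟨a, b, ha, hb, hab⟩ := h.exists_map_add hli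
  have h1 : 0 < F x o := by
    rw [h.pos_iff x hx0 o ho, hx]
    exact one_pos
  have h2 : F v o = 0 := by rwa [h.zero_iff v hv0 o ho]
  refine ⟨(a * F x o)⁻¹ * b, by positivity, ?_⟩
  ext w
  simp only [chart, hab, LinearMap.sub_apply, LinearMap.smul_apply, LinearMap.add_apply,
    smul_eq_mul, h2, mul_zero, add_zero]
  field_simp
  ring

/-- Opposite sides of a parallelogram with linearly independent sides have the same image. -/
theorem chart_sub_add_of_linearIndependent (h : SignCompatible F J) {o x v w : E} (ho : o ≠ 0)
    (hx : J o x = 1) (hv : J o v = 0) (hw : J o w = 0) (hvw : LinearIndependent ℝ ![v, w]) :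
    chart F o (x + w + v) - chart F o (x + w) = chart F o (x + v) - chart F o x := by
  have hv0 : v ≠ 0 := hvw.ne_zero 0
  have hw0 : w ≠ 0 := hvw.ne_zero 1
  obtain ⟨a, -, h1⟩ := h.chart_sub ho hx hv hv0
  obtain ⟨b, -, h2⟩ := h.chart_sub (x := x + w) ho (by rw [map_add, hx, hw, add_zero]) hv hv0
  obtain ⟨c, -, h3⟩ := h.chart_sub ho hx hw hw0
  obtain ⟨d, -, h4⟩ := h.chart_sub (x := x + v) ho (by rw [map_add, hx, hv, add_zero]) hw hw0
  obtain ⟨e, hew, hev⟩ :=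
    h.exists_separating (LinearIndependent.pair_symm_iff.1 hvw)
  have h5 : a • F v + d • F w = c • F w + b • F v := by
    rw [← h1, ← h2, ← h3, ← h4, add_right_comm x w v]
    abel
  have h6 := LinearMap.congr_fun h5 e
  simp only [LinearMap.add_apply, LinearMap.smul_apply, hew, hev, smul_eq_mul, mul_zero, mul_one,
    add_zero, zero_add] at h6
  rw [h1, h2, h6]

variable [FiniteDimensional ℝ E]

theorem exists_linearIndependent_of_finrank (hdim : 3 ≤ Module.finrank ℝ E) (j : E →ₗ[ℝ] ℝ)
    {v : E} (hv0 : v ≠ 0) : ∃ w, j w = 0 ∧ LinearIndependent ℝ ![v, w] := by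
  by_contra hcon
  push Not at hcon
  have h1 : LinearMap.ker j ≤ Submodule.span ℝ {v} := by
    intro w hw
    have := hcon w hw
    rw [LinearIndependent.pair_iff' hv0] at this
    push Not at this
    obtain ⟨a, ha⟩ := this
    exact Submodule.mem_span_singleton.2 ⟨a, ha⟩
  have h2 := Submodule.finrank_mono h1
  rw [finrank_span_singleton hv0] at h2
  have h3 := j.finrank_range_add_finrank_ker
  have h4 := Submodule.finrank_le (LinearMap.range j)
  rw [Module.finrank_self] at h4
  omega

theorem chart_sub_add (h : SignCompatible F J) (hdim : 3 ≤ Module.finrank ℝ E) {o x v w : E}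
    (ho : o ≠ 0) (hx : J o x = 1) (hv : J o v = 0) (hw : J o w = 0) :
    chart F o (x + w + v) - chart F o (x + w) = chart F o (x + v) - chart F o x := by
  by_cases hv0 : v = 0
  · simp [hv0]
  by_cases hvw : LinearIndependent ℝ ![v, w]
  · exact h.chart_sub_add_of_linearIndependent ho hx hv hw hvw
  -- Parallel translations are composed of two translations in independent directions.
  obtain ⟨u, hu, hvu⟩ := exists_linearIndependent_of_finrank hdim (J o) hv0
  have hvu' : LinearIndependent ℝ ![v, w - u] := by
    rw [LinearIndependent.pair_iff' hv0] at hvw hvu ⊢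
    push Not at hvw
    obtain ⟨a, ha⟩ := hvw
    intro b hb
    exact hvu (a - b) (by rw [sub_smul, ha, hb]; abel)
  have h1 := h.chart_sub_add_of_linearIndependent ho hx hv hu hvu
  have h2 := h.chart_sub_add_of_linearIndependent (x := x + u) (w := w - u) ho
    (by rw [map_add, hx, hu, add_zero]) hv (by rw [map_sub, hw, hu, sub_zero]) hvu'
  rw [show x + u + (w - u) = x + w by abel] at h2
  rw [h2, h1]

/-- A map to functionals that is sign compatible with a family of functionals is, up to positive
factors, linear. This is the fundamental theorem of projective geometry for `F`: in the affine
chart `J o = 1`, normalised by the value at `o`, the map `F` takes parallelograms to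
parallelograms. -/
theorem exists_linear (h : SignCompatible F J) (hdim : 3 ≤ Module.finrank ℝ E) :
    ∃ B : E →ₗ[ℝ] E →ₗ[ℝ] ℝ, ∀ x, x ≠ 0 → ∃ c : ℝ, 0 < c ∧ B x = c • F x := by
  have : Nontrivial E := Module.nontrivial_of_finrank_pos (R := ℝ) (by omega)
  obtain ⟨o, ho⟩ := exists_ne (0 : E)
  set x₀ : E := (J o o)⁻¹ • o with hx₀
  have hjx : J o x₀ = 1 := by
    rw [hx₀, map_smul, smul_eq_mul, inv_mul_cancel₀ (h.pos_self ho).ne']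
  set m : E → E →ₗ[ℝ] ℝ := fun v => chart F o (x₀ + v) - chart F o x₀ with hm
  have hm0 : m 0 = 0 := by simp [hm]
  have hmF : ∀ v, J o v = 0 → v ≠ 0 → ∃ c : ℝ, 0 < c ∧ m v = c • F v := fun v hv hv0 =>
    h.chart_sub ho hjx hv hv0
  have hmadd : ∀ v w, J o v = 0 → J o w = 0 → m (v + w) = m v + m w := by
    intro v w hv hw
    have h1 := h.chart_sub_add hdim ho hjx hv hw
    simp only [hm]
    rw [← h1, add_assoc, add_comm w v]
    abel
  have hJs : ∀ v, J o v = 0 → ∀ t : ℝ, J o (t • v) = 0 := fun v hv t => by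
    rw [map_smul, hv, smul_zero]
  have hmsmul : ∀ v, J o v = 0 → ∀ t : ℝ, m (t • v) = t • m v := by
    intro v hv t
    by_cases hv0 : v = 0
    · simp [hv0, hm0]
    -- All `m (t • v)` are multiples of `F v`; the multiplier is additive and positive.
    have hmul : ∀ s : ℝ, m (s • v) = m (s • v) v • F v := by
      intro s
      by_cases hs : s = 0
      · simp [hs, hm0]
      · obtain ⟨c, -, hc⟩ := hmF _ (hJs v hv s) (smul_ne_zero hs hv0)
        rw [hc, h.smul v hv0 s hs]
        simp [h.self v hv0, smul_smul]
    have hlin := map_eq_mul_map_one_of_nonneg (f := fun s => m (s • v) v)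
      (fun s u => by
        rw [add_smul, hmadd _ _ (hJs v hv s) (hJs v hv u), LinearMap.add_apply])
      (fun s hs => by
        rcases hs.eq_or_lt with rfl | hs
        · simp [hm0]
        · obtain ⟨c, hc, hc'⟩ := hmF _ (hJs v hv s) (smul_ne_zero hs.ne' hv0)
          rw [hc', h.smul v hv0 s hs.ne']
          simp only [LinearMap.smul_apply, h.self v hv0, smul_eq_mul, mul_one]
          positivity) t
    simp only [one_smul] at hlin
    rw [hmul t, hlin, mul_smul]
    congr 1
    have := hmul 1
    rw [one_smul] at this
    exact this.symm
  have hJr : ∀ x, J o (x - J o x • x₀) = 0 := fun x => by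
    rw [map_sub, map_smul, hjx, smul_eq_mul, mul_one, sub_self]
  let B : E →ₗ[ℝ] E →ₗ[ℝ] ℝ :=
    { toFun := fun x => m (x - J o x • x₀) + J o x • chart F o x₀
      map_add' := fun x y => by
        have h1 : x + y - J o (x + y) • x₀ = (x - J o x • x₀) + (y - J o y • x₀) := by
          rw [map_add]
          module
        rw [h1, hmadd _ _ (hJr x) (hJr y), map_add]
        module
      map_smul' := fun t x => by
        have h1 : t • x - J o (t • x) • x₀ = t • (x - J o x • x₀) := by
          rw [map_smul, smul_eq_mul]
          module
        rw [h1, hmsmul _ (hJr x), map_smul, RingHom.id_apply, smul_eq_mul]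
        module }
  refine ⟨B, fun x hx => ?_⟩
  have hB : B x = m (x - J o x • x₀) + J o x • chart F o x₀ := rfl
  by_cases hs : J o x = 0
  · rw [hB, hs, zero_smul, zero_smul, sub_zero, add_zero]
    exact hmF x hs hx
  · set s := J o x with hsdef
    have hxs : s⁻¹ • x ≠ 0 := smul_ne_zero (inv_ne_zero hs) hx
    have h1 : B x = s • chart F o (s⁻¹ • x) := by
      have h2 : x - s • x₀ = s • (s⁻¹ • x - x₀) := by
        rw [smul_sub, smul_inv_smul₀ hs]
      have h3 : J o (s⁻¹ • x - x₀) = 0 := by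
        rw [map_sub, map_smul, hjx, smul_eq_mul, ← hsdef, inv_mul_cancel₀ hs, sub_self]
      rw [hB, h2, hmsmul _ h3, ← smul_add]
      congr 1
      simp [hm]
    have h4 : 0 < F (s⁻¹ • x) o := by
      rw [h.pos_iff _ hxs o ho, map_smul, smul_eq_mul, ← hsdef, inv_mul_cancel₀ hs]
      exact one_pos
    refine ⟨s * (F (s⁻¹ • x) o)⁻¹ * s, ?_, ?_⟩
    · have : 0 < s * s := mul_self_pos.2 hs
      rw [mul_right_comm]
      positivity
    · rw [h1, chart]
      conv_lhs => rw [h.smul x hx _ (inv_ne_zero hs)]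
      rw [h.smul x hx _ (inv_ne_zero hs), inv_inv, smul_smul, smul_smul]

end SignCompatible

end ProjectiveLinearity

/-! ### From the bilinear form to the parallelogram law -/

section Euclidean

/-- The inequality integrates to `N (θ + φ) ≥ exp (ω φ) * N θ`, and periodicity forces `ω = 0`. -/
theorem eq_of_rotation_le {N : ℝ → ℝ} {ω : ℝ} (hpos : ∀ θ, 0 < N θ)
    (hper : Function.Periodic N (2 * Real.pi))
    (h : ∀ θ δ, 0 < Real.cos δ + ω * Real.sin δ →
      (Real.cos δ + ω * Real.sin δ) * N θ ≤ N (θ + δ)) (θ φ : ℝ) : N θ = N φ := by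
  have hiter : ∀ δ, 0 < Real.cos δ + ω * Real.sin δ → ∀ (n : ℕ) (θ : ℝ),
      (Real.cos δ + ω * Real.sin δ) ^ n * N θ ≤ N (θ + n * δ) := by
    intro δ hδ n
    induction n with
    | zero => intro θ; simp
    | succ n ih =>
      intro θ
      calc (Real.cos δ + ω * Real.sin δ) ^ (n + 1) * N θ
          = (Real.cos δ + ω * Real.sin δ) * ((Real.cos δ + ω * Real.sin δ) ^ n * N θ) := by ring
        _ ≤ (Real.cos δ + ω * Real.sin δ) * N (θ + n * δ) := by gcongr; exact ih θ
        _ ≤ N (θ + n * δ + δ) := h _ _ hδ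
        _ = N (θ + (n + 1 : ℕ) * δ) := by push_cast; ring_nf
  have hexp : ∀ θ φ, Real.exp (ω * φ) * N θ ≤ N (θ + φ) := by
    intro θ φ
    set g : ℕ → ℝ := fun n => Real.cos (φ / n) + ω * Real.sin (φ / n) - 1 with hg
    have hdiv : Tendsto (fun n : ℕ => φ / n) atTop (𝓝 0) := tendsto_const_div_atTop_nhds_zero_nat φ
    have hD : HasDerivAt (fun s : ℝ => Real.cos (φ * s) + ω * Real.sin (φ * s)) (ω * φ) 0 := by
      have h1 : HasDerivAt (fun s : ℝ => φ * s) φ 0 := by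
        simpa using (hasDerivAt_id (0 : ℝ)).const_mul φ
      have h2 := h1.cos.fun_add (h1.sin.const_mul ω)
      simpa using h2
    have hng : Tendsto (fun n : ℕ => (n : ℝ) * g n) atTop (𝓝 (ω * φ)) := by
      have h1 := hD.tendsto_slope_zero_right
      have h2 : Tendsto (fun n : ℕ => ((n : ℝ))⁻¹) atTop (𝓝[>] 0) :=
        tendsto_inv_atTop_nhdsGT_zero.comp tendsto_natCast_atTop_atTop
      refine (h1.comp h2).congr fun n => ?_
      simp [hg, div_eq_mul_inv]
    have hlim := Real.tendsto_one_add_pow_exp_of_tendsto hng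
    refine le_of_tendsto (hlim.mul_const (N θ)) ?_
    have hcont : Continuous fun s : ℝ => Real.cos s + ω * Real.sin s := by fun_prop
    have hev : ∀ᶠ n : ℕ in atTop, 0 < Real.cos (φ / n) + ω * Real.sin (φ / n) := by
      have h1 := (hcont.tendsto 0).comp hdiv
      exact h1.eventually (lt_mem_nhds (by simp))
    filter_upwards [hev, eventually_gt_atTop 0] with n hn hn0
    have h1 := hiter _ hn n θ
    have hn0' : (n : ℝ) ≠ 0 := by positivity
    rw [mul_div_cancel₀ _ hn0'] at h1
    rwa [show 1 + g n = Real.cos (φ / n) + ω * Real.sin (φ / n) by simp only [hg]; ring]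
  have hω : ω = 0 := by
    have h1 := hexp 0 (2 * Real.pi)
    rw [hper 0] at h1
    have h2 := hexp (2 * Real.pi) (-(2 * Real.pi))
    rw [add_neg_cancel, ← zero_add (2 * Real.pi), hper 0, zero_add] at h2
    have h3 : Real.exp (ω * (2 * Real.pi)) ≤ 1 := by
      refine le_of_mul_le_mul_right ?_ (hpos 0)
      rwa [one_mul]
    have h4 : Real.exp (ω * -(2 * Real.pi)) ≤ 1 := by
      refine le_of_mul_le_mul_right ?_ (hpos 0)
      rwa [one_mul]
    rw [Real.exp_le_one_iff] at h3 h4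
    have hpi := Real.pi_pos
    apply le_antisymm <;> nlinarith
  have hle : ∀ θ φ, N θ ≤ N φ := by
    intro θ φ
    have h1 := hexp θ (φ - θ)
    rwa [hω, zero_mul, Real.exp_zero, one_mul, add_sub_cancel] at h1
  exact le_antisymm (hle θ φ) (hle φ θ)

variable {E : Type*} [NormedAddCommGroup E] [NormedSpace ℝ E]

/-- Rotating from `a` towards `b` on the unit circle of the symmetric part of `B`, the norm changes
at the constant logarithmic rate `B b a`, which vanishes because the norm is periodic. -/
theorem norm_eq_on_circle {B : E →ₗ[ℝ] E →ₗ[ℝ] ℝ}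
    (horth : ∀ x y, B x y = 0 → ‖y‖ ≤ ‖y + x‖) {a b : E} (ha : B a a = 1) (hb : B b b = 1)
    (hab : B a b = -B b a) (θ φ : ℝ) :
    ‖Real.cos θ • a + Real.sin θ • b‖ = ‖Real.cos φ • a + Real.sin φ • b‖ := by
  set z : ℝ → E := fun θ => Real.cos θ • a + Real.sin θ • b with hz
  have hzz : ∀ θ δ, B (z (θ + δ)) (z θ) = Real.cos δ + B b a * Real.sin δ := by
    intro θ δ
    simp only [hz, map_add, map_smul, LinearMap.add_apply, LinearMap.smul_apply, smul_eq_mul, ha,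
      hb, hab, Real.cos_add, Real.sin_add]
    linear_combination (Real.cos δ + B b a * Real.sin δ) * Real.sin_sq_add_cos_sq θ
  have hz1 : ∀ θ, B (z θ) (z θ) = 1 := by
    intro θ
    have h1 := hzz θ 0
    simpa using h1
  refine eq_of_rotation_le (N := fun θ => ‖z θ‖) (ω := B b a) ?_ ?_ ?_ θ φ
  · intro θ
    rw [norm_pos_iff]
    intro h0
    have := hz1 θ
    rw [h0] at this
    simp at this
  · intro θ
    simp [hz]
  · intro θ δ hδ
    set k := Real.cos δ + B b a * Real.sin δ with hk
    have h1 := horth (k⁻¹ • z (θ + δ) - z θ) (z θ) (by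
      rw [map_sub, map_smul, LinearMap.sub_apply, LinearMap.smul_apply, hzz, hz1, ← hk,
        smul_eq_mul, inv_mul_cancel₀ hδ.ne', sub_self])
    rw [add_sub_cancel, norm_smul, Real.norm_eq_abs, abs_of_pos (inv_pos.2 hδ)] at h1
    rwa [← div_eq_inv_mul, le_div_iff₀ hδ, mul_comm] at h1

theorem norm_eq_of_apply_self_eq_one {B : E →ₗ[ℝ] E →ₗ[ℝ] ℝ} (hB : ∀ x, x ≠ 0 → 0 < B x x)
    (horth : ∀ x y, B x y = 0 → ‖y‖ ≤ ‖y + x‖) {u v : E} (hu : B u u = 1) (hv : B v v = 1) :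
    ‖u‖ = ‖v‖ := by
  set t := (B u v + B v u) / 2 with ht
  set r := v - t • u with hr
  have hrr : B r r = 1 - t ^ 2 := by
    simp only [hr, map_sub, map_smul, LinearMap.sub_apply, LinearMap.smul_apply, smul_eq_mul, hu,
      hv]
    rw [ht]
    ring
  by_cases hr0 : r = 0
  · have hvt : v = t • u := sub_eq_zero.1 hr0
    rw [hr0, map_zero] at hrr
    have ht1 : |t| = 1 := by
      have : t ^ 2 = 1 := by linarith
      rw [← sq_abs] at this
      nlinarith [abs_nonneg t]
    rw [hvt, norm_smul, Real.norm_eq_abs, ht1, one_mul]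
  · have hpos := hB r hr0
    rw [hrr] at hpos
    set s := √(1 - t ^ 2) with hs
    have hs0 : 0 < s := Real.sqrt_pos.2 hpos
    have hss : s ^ 2 = 1 - t ^ 2 := Real.sq_sqrt hpos.le
    have hur : B u r + B r u = 0 := by
      simp only [hr, map_sub, map_smul, LinearMap.sub_apply, LinearMap.smul_apply, smul_eq_mul, hu]
      rw [ht]
      ring
    have hbb : B (s⁻¹ • r) (s⁻¹ • r) = 1 := by
      simp only [map_smul, LinearMap.smul_apply, smul_eq_mul, hrr, ← hss]
      field_simp
    have hub : B u (s⁻¹ • r) = -B (s⁻¹ • r) u := by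
      simp only [map_smul, LinearMap.smul_apply, smul_eq_mul]
      linear_combination s⁻¹ * hur
    have h1 := norm_eq_on_circle horth hu hbb hub 0 (Real.arccos t)
    have ht' : -1 ≤ t ∧ t ≤ 1 := by
      rw [← abs_le, ← sq_le_one_iff_abs_le_one]
      linarith
    rw [Real.cos_arccos ht'.1 ht'.2, Real.sin_arccos, ← hs, smul_inv_smul₀ hs0.ne', hr] at h1
    simpa using h1

theorem parallelogram_of_bilinear {B : E →ₗ[ℝ] E →ₗ[ℝ] ℝ} (hB : ∀ x, x ≠ 0 → 0 < B x x)
    (horth : ∀ x y, B x y = 0 → ‖y‖ ≤ ‖y + x‖) (x y : E) :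
    ‖x + y‖ * ‖x + y‖ + ‖x - y‖ * ‖x - y‖ = 2 * (‖x‖ * ‖x‖ + ‖y‖ * ‖y‖) := by
  have hunit : ∀ v, v ≠ 0 → B ((√(B v v))⁻¹ • v) ((√(B v v))⁻¹ • v) = 1 := by
    intro v hv
    have h1 := Real.mul_self_sqrt (hB v hv).le
    have h2 : √(B v v) ≠ 0 := (Real.sqrt_pos.2 (hB v hv)).ne'
    simp only [map_smul, LinearMap.smul_apply, smul_eq_mul]
    field_simp
    linarith
  obtain ⟨C, hC⟩ : ∃ C : ℝ, ∀ v, ‖v‖ * ‖v‖ = C * B v v := by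
    by_cases hx : ∃ e : E, e ≠ 0
    · obtain ⟨e, he⟩ := hx
      refine ⟨‖(√(B e e))⁻¹ • e‖ * ‖(√(B e e))⁻¹ • e‖, fun v => ?_⟩
      by_cases hv : v = 0
      · simp [hv]
      have h1 := norm_eq_of_apply_self_eq_one hB horth (hunit e he) (hunit v hv)
      have h2 := Real.mul_self_sqrt (hB v hv).le
      have h3 : 0 < √(B v v) := Real.sqrt_pos.2 (hB v hv)
      rw [h1, norm_smul, Real.norm_eq_abs, abs_of_pos (inv_pos.2 h3)]
      generalize √(B v v) = r at h2 h3
      rw [← h2]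
      field_simp
    · push Not at hx
      exact ⟨0, fun v => by simp [hx v]⟩
  simp only [hC, map_add, map_sub, LinearMap.add_apply, LinearMap.sub_apply]
  ring

theorem HasContractiveProjections.parallelogram [FiniteDimensional ℝ E]
    (hdim : 3 ≤ Module.finrank ℝ E) (H : HasContractiveProjections E) (x y : E) :
    ‖x + y‖ * ‖x + y‖ + ‖x - y‖ * ‖x - y‖ = 2 * (‖x‖ * ‖x‖ + ‖y‖ * ‖y‖) := by
  have hsc := H.strictConvexSpace hdim
  have hsc' := H.strictConvexSpace_dual hdim
  have hex : ∀ x : E, ∃ f : E →ₗ[ℝ] ℝ, x ≠ 0 → IsContractiveAlong x f := by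
    intro x
    by_cases hx : x = 0
    · exact ⟨0, fun h => absurd hx h⟩
    · obtain ⟨f, hf⟩ := H x hx
      exact ⟨f, fun _ => hf⟩
  choose F hF using hex
  choose J hJ using fun z : E => exists_isNorming z
  have hzero : ∀ x, x ≠ 0 → ∀ z, z ≠ 0 → (F x z = 0 ↔ J z x = 0) := fun x hx z hz =>
    ⟨(hF x hx).isNorming_eq_zero hz (hJ z), (hF x hx).eq_zero_of_isNorming (hJ z)⟩
  have hFJ : SignCompatible F (fun z => (J z : E →ₗ[ℝ] ℝ)) := by
    refine ⟨fun x hx => (hF x hx).1, fun x hx t ht => ?_, hzero, fun x hx z hz => ?_⟩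
    · exact (hF _ (smul_ne_zero ht hx)).unique ((hF x hx).smul ht)
    · have h1 := (hF x hx).mul_nonneg (hJ z)
      constructor
      · intro h2
        have h3 : 0 ≤ J z x := nonneg_of_mul_nonneg_right h1 h2
        exact lt_of_le_of_ne h3 fun h4 => h2.ne' ((hzero x hx z hz).2 h4.symm)
      · intro h2
        have h3 : 0 ≤ F x z := nonneg_of_mul_nonneg_left h1 h2
        exact lt_of_le_of_ne h3 fun h4 => h2.ne' ((hzero x hx z hz).1 h4.symm)
  obtain ⟨B, hB⟩ := hFJ.exists_linear hdim
  refine parallelogram_of_bilinear (B := B) (fun x hx => ?_) (fun x y hxy => ?_) x y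
  · obtain ⟨c, hc, hBx⟩ := hB x hx
    rw [hBx, LinearMap.smul_apply, (hF x hx).1]
    simpa using hc
  · by_cases hx : x = 0
    · simp [hx]
    obtain ⟨c, hc, hBx⟩ := hB x hx
    rw [hBx, LinearMap.smul_apply, smul_eq_mul] at hxy
    have h1 := (hF x hx).norm_le ((mul_eq_zero.1 hxy).resolve_left hc.ne') 1
    rwa [one_smul] at h1

end Euclidean

/-! ### Almost transitive spaces -/

section AlmostTransitive

variable {X : Type*} [NormedAddCommGroup X] [NormedSpace ℝ X]

theorem IsOneComplemented.exists_isContractiveAlong {Y : Submodule ℝ X} (hY : IsHyperplane Y)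
    (h : IsOneComplemented Y) : ∃ (x : X) (f : X →ₗ[ℝ] ℝ), IsContractiveAlong x f := by
  obtain ⟨P, hP, hrange, hnorm⟩ := h
  have hPP : ∀ v, P (P v) = P v := fun v => congrArg (fun Q : X →L[ℝ] X => Q v) hP.eq
  have hmem : ∀ v, v ∈ Y ↔ P v = v := by
    intro v
    rw [← hrange]
    constructor
    · rintro ⟨w, rfl⟩
      exact hPP w
    · intro hv
      exact ⟨v, hv⟩
  obtain ⟨x, hx⟩ : ∃ x, x ∉ Y := by
    by_contra hcon
    push Not at hcon
    have htop : Y = ⊤ := Submodule.eq_top_iff'.2 hcon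
    have h1 : Module.finrank ℝ (X ⧸ Y) = 1 := hY
    have : Subsingleton (X ⧸ Y) := Submodule.Quotient.subsingleton_iff.2 htop
    rw [Module.finrank_zero_of_subsingleton] at h1
    exact zero_ne_one h1
  set x₀ := x - P x with hx₀
  have hx₀0 : x₀ ≠ 0 := fun h0 => hx ((hmem x).2 (sub_eq_zero.1 h0).symm)
  have hPx₀ : P x₀ = 0 := by rw [hx₀, map_sub, hPP, sub_self]
  have hmk : Y.mkQ x₀ ≠ 0 := by
    intro h0
    rw [Submodule.mkQ_apply, Submodule.Quotient.mk_eq_zero, hmem, hPx₀] at h0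
    exact hx₀0 h0.symm
  have hcoord : ∀ z, ∃ c : ℝ, P z = z - c • x₀ := by
    intro z
    obtain ⟨c, hc⟩ := (finrank_eq_one_iff_of_nonzero' _ hmk).1 hY (Y.mkQ z)
    refine ⟨c, ?_⟩
    rw [← map_smul] at hc
    have h1 : z - c • x₀ ∈ Y := (Submodule.Quotient.eq Y).1 hc.symm
    rw [hmem, map_sub, map_smul, hPx₀, smul_zero, sub_zero] at h1
    exact h1
  choose f hf using hcoord
  have hinj := smul_left_injective ℝ hx₀0
  refine ⟨x₀, ⟨⟨f, fun a b => hinj ?_⟩, fun t a => hinj ?_⟩, hinj ?_, fun z => ?_⟩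
  · have h1 := hf (a + b)
    rw [map_add, hf a, hf b] at h1
    change f (a + b) • x₀ = (f a + f b) • x₀
    rw [add_smul, ← sub_eq_zero]
    rw [← sub_eq_zero] at h1
    rw [← h1]
    abel
  · have h1 := hf (t • a)
    rw [map_smul, hf a, smul_sub] at h1
    change f (t • a) • x₀ = (t * f a) • x₀
    rw [mul_smul]
    exact (sub_right_injective h1).symm
  · have h1 := hf x₀
    rw [hPx₀] at h1
    change f x₀ • x₀ = (1 : ℝ) • x₀
    rw [one_smul]
    exact (sub_eq_zero.1 h1.symm).symm
  · change ‖z - f z • x₀‖ ≤ ‖z‖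
    rw [← hf z]
    simpa [hnorm] using P.le_opNorm z

theorem IsContractiveAlong.comp_symm {x : X} {f : X →ₗ[ℝ] ℝ} (h : IsContractiveAlong x f)
    (T : X ≃ₗᵢ[ℝ] X) :
    IsContractiveAlong (T x) (f.comp (T.symm.toLinearEquiv : X →ₗ[ℝ] X)) := by
  refine ⟨by simpa using h.1, fun z => ?_⟩
  have h1 := h.2 (T.symm z)
  rw [← T.norm_map, map_sub, map_smul, T.apply_symm_apply, T.symm.norm_map] at h1
  exact h1

/-- Isometries transport one contractive projection along a dense orbit of directions, and the
limits exist by compactness. -/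
theorem IsAlmostTransitive.hasContractiveProjections (htrans : IsAlmostTransitive X) {x₀ : X}
    {f₀ : X →ₗ[ℝ] ℝ} (h₀ : IsContractiveAlong x₀ f₀) : HasContractiveProjections X := by
  have hx₀ : 0 < ‖x₀‖ := norm_pos_iff.2 h₀.ne_zero
  have h₁ := h₀.smul (t := ‖x₀‖⁻¹) (inv_ne_zero hx₀.ne')
  have hmem : ∀ x : X, x ≠ 0 → ‖x‖⁻¹ • x ∈ Metric.sphere (0 : X) 1 := fun x hx => by
    simpa using norm_smul_inv_norm (𝕜 := ℝ) hx
  intro x hx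
  obtain ⟨u, hu, hlim⟩ :=
    mem_closure_iff_seq_limit.1 (htrans _ (hmem x₀ h₀.ne_zero) (hmem x hx))
  choose T hT using hu
  have hTu : ∀ n, ∃ f, IsContractiveAlong (u n) f := fun n => by
    rw [← hT n]
    exact ⟨_, h₁.comp_symm (T n)⟩
  choose f hf using hTu
  have hxn : ‖x‖ ≠ 0 := norm_ne_zero_iff.2 hx
  obtain ⟨g, hg, -⟩ := IsContractiveAlong.exists_of_tendsto
    (smul_ne_zero (inv_ne_zero hxn) hx) hlim hf
  have h2 := hg.smul hxn
  rw [smul_inv_smul₀ hxn] at h2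
  exact ⟨_, h2⟩

theorem HasContractiveProjections.submodule (H : HasContractiveProjections X)
    (E : Submodule ℝ X) : HasContractiveProjections E := by
  intro x hx
  obtain ⟨f, hf⟩ := H x (by simpa using hx)
  exact ⟨f.comp E.subtype, hf.1, fun z => hf.2 z⟩

/-- The parallelogram law is checked in a finite-dimensional subspace, of dimension at least three,
containing both vectors. -/
theorem HasContractiveProjections.parallelogram_of_rank (hdim : 3 ≤ Module.rank ℝ X)
    (H : HasContractiveProjections X) (x y : X) :
    ‖x + y‖ * ‖x + y‖ + ‖x - y‖ * ‖x - y‖ = 2 * (‖x‖ * ‖x‖ + ‖y‖ * ‖y‖) := by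
  classical
  obtain ⟨s, hs, hli⟩ := le_rank_iff_exists_linearIndependent_finset (n := 3).1
    (by exact_mod_cast hdim)
  set t : Finset X := s ∪ {x, y} with ht
  set E : Submodule ℝ X := Submodule.span ℝ (t : Set X) with hE
  have hfin : FiniteDimensional ℝ E := FiniteDimensional.span_finset ℝ t
  have hrank : 3 ≤ Module.finrank ℝ E := by
    have h1 : Module.finrank ℝ (Submodule.span ℝ (s : Set X)) = 3 := by
      rw [finrank_span_finset_eq_card hli, hs]
    rw [← h1]
    exact Submodule.finrank_mono (Submodule.span_mono (by
      rw [ht, Finset.coe_union]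
      exact Set.subset_union_left))
  have hx : x ∈ E := Submodule.subset_span (by simp [ht])
  have hy : y ∈ E := Submodule.subset_span (by simp [ht])
  exact (H.submodule E).parallelogram hrank ⟨x, hx⟩ ⟨y, hy⟩

end AlmostTransitive

theorem theorem1p1 {X : Type u} [NormedAddCommGroup X] [NormedSpace ℝ X] [CompleteSpace X]
    (hdim : 3 ≤ Module.rank ℝ X)
    (hcompl : ∃ Y : Submodule ℝ X, IsHyperplane Y ∧ IsOneComplemented Y)
    (htrans : IsAlmostTransitive X) :
    ∃ (H : Type u) (_ : NormedAddCommGroup H) (_ : InnerProductSpace ℝ H) (_ : CompleteSpace H),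
      Nonempty (X ≃ₗᵢ[ℝ] H) := by
  obtain ⟨Y, hY, hYc⟩ := hcompl
  obtain ⟨x₀, f₀, h₀⟩ := hYc.exists_isContractiveAlong hY
  have H := htrans.hasContractiveProjections h₀
  let inner : InnerProductSpace ℝ X :=
    InnerProductSpace.ofNorm ℝ (H.parallelogram_of_rank hdim)
  exact ⟨X, inferInstance, inner, inferInstance, ⟨LinearIsometryEquiv.refl ℝ X⟩⟩
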